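/- Let $d,r\ge 1$ be integers with $\gcd(d,r)=1$ such that either $d\ge 3+r$, or $r=1$ and $d\in\{2,3\}$. Let $n$ be an integer with $n\equiv -r\pmod d$ and $n\ge 2d-r$. Then, in the field $\mathbb{Q}(q)$ of rational functions in an indeterminate $q$, $$\sum_{k=0}^{n-1}\frac{(q^{d+r};q^d)_k^{\,d-r}\,(q^r;q^d)_k^{\,r-1}\,(q^{r-d};q^d)_k\,q^{dk}}{(q^d;q^d)_k^{\,d}} \equiv \frac{(1-q^r)^r(1-q^{d-r})\,(q^d;q^d)_{n-1-(n+r)/d}}{-(-1)^{n-1-(n+r)/d}\,(q^d;q^d)_{(n+r)/d}^{\,d-1}}\;q^{A(d,n,r)}\pmod{\Phi_n(q)^2},$$ where $$A(d,n,r)=\frac{d(d+n)(n+r)+dn(r-1)-(n+r)^2}{2d}-\frac{r(r+1)}{2}\in\mathbb{Z}.$$ Here $(x;b)_k=\prod_{i=0}^{k-1}(1-xb^i)$, $\Phi_n(q)$ is the $n$-th cyclotomic polynomial, and for $f,g\in\mathbb{Q}(q)$ and $P\in\mathbb{Q}[q]$ the congruence $f\equiv g\pmod P$ means $f-g=PA/B$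 with $A,B\in\mathbb{Q}[q]$ and $B$ coprime to $P$. -/

import Mathlib

noncomputable section

namespace QSuper

/-- The indeterminate `q`, as an element of the field `ℚ(q)` of rational functions. -/
abbrev q : RatFunc ℚ := RatFunc.X

/-- The `q`-shifted factorial `(x; b)_n = (1 - x)(1 - x b) ⋯ (1 - x b^(n-1))`, with `(x; b)_0 = 1`,
for an argument `x` and a base `b` in a field. -/
def qPoch {K : Type*} [Field K] (x b : K) (n : ℕ) : K :=
  ∏ i ∈ Finset.range n, (1 - x * b ^ i)

/-- Congruence of rational functions modulo a polynomial `P`: the difference `f - g` is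
`P * A / B` with polynomials `A`, `B`, where `B` is coprime to `P`. -/
def CongrMod (P : Polynomial ℚ) (f g : RatFunc ℚ) : Prop :=
  ∃ A B : Polynomial ℚ, IsCoprime B P ∧
    f - g = algebraMap (Polynomial ℚ) (RatFunc ℚ) (P * A) / algebraMap (Polynomial ℚ) (RatFunc ℚ) B

/-- The exponent
`A(d, n, r) = [d (d + n) (n + r) + d n (r - 1) - (n + r) ^ 2] / (2 d) - r (r + 1) / 2`.
Both divisions are exact when `d ∣ n + r`, see `expA_cast`. -/
def expA (d n r : ℤ) : ℤ :=
  (d * (d + n) * (n + r) + d * n * (r - 1) - (n + r) ^ 2) / (2 * d) - r * (r + 1) / 2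

/-- The integer divisions in `expA` agree with the divisions of rational numbers. -/
theorem expA_cast {d n r : ℤ} (hd : d ≠ 0) (h : d ∣ n + r) :
    (expA d n r : ℚ) =
      ((d : ℚ) * (d + n) * (n + r) + d * n * (r - 1) - (n + r) ^ 2) / (2 * d)
        - (r : ℚ) * (r + 1) / 2 := by
  obtain ⟨m, hm⟩ := h
  obtain rfl : n = d * m - r := by linarith
  have h1 : (2 * d) ∣ d * (d + (d * m - r)) * ((d * m - r) + r) + d * (d * m - r) * (r - 1)
      - ((d * m - r) + r) ^ 2 := by
    obtain ⟨b, hb⟩ := (Int.even_mul_succ_self m).two_dvd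
    obtain ⟨c, hc⟩ := (Int.even_mul_succ_self (r - 1)).two_dvd
    refine ⟨d * (d - 1) * b - c, ?_⟩
    linear_combination d ^ 2 * (d - 1) * hb - d * hc
  have h2 : (2 : ℤ) ∣ r * (r + 1) := (Int.even_mul_succ_self r).two_dvd
  have hd' : ((2 * d : ℤ) : ℚ) ≠ 0 := by exact_mod_cast mul_ne_zero two_ne_zero hd
  unfold expA
  rw [Int.cast_sub, Int.cast_div h1 hd', Int.cast_div h2 (by norm_num)]
  push_cast
  ring

end QSuper

end

noncomputable section

namespace QSuper

section Summation

variable {K : Type*} [Field K]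

theorem qPoch_zero (x b : K) : qPoch x b 0 = 1 := by simp [qPoch]

theorem qPoch_succ (x b : K) (k : ℕ) : qPoch x b (k + 1) = qPoch x b k * (1 - x * b ^ k) := by
  simp [qPoch, Finset.prod_range_succ]

theorem qPoch_succ' (x b : K) (k : ℕ) :
    qPoch x b (k + 1) = (1 - x) * qPoch (x * b) b k := by
  simp only [qPoch, Finset.prod_range_succ', pow_zero, mul_one]
  rw [mul_comm]
  congr 1
  exact Finset.prod_congr rfl fun i _ => by ring

theorem qPoch_add (x b : K) (k l : ℕ) :
    qPoch x b (k + l) = qPoch x b k * qPoch (x * b ^ k) b l := by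
  simp only [qPoch, Finset.prod_range_add]
  congr 1
  exact Finset.prod_congr rfl fun i _ => by ring

theorem qPoch_mul_qPoch_comm (x b : K) (k l : ℕ) :
    qPoch x b k * qPoch (x * b ^ k) b l = qPoch x b l * qPoch (x * b ^ l) b k := by
  rw [← qPoch_add, ← qPoch_add, add_comm]

theorem qPoch_ne_zero {x b : K} {k : ℕ} (h : ∀ i < k, 1 - x * b ^ i ≠ 0) : qPoch x b k ≠ 0 :=
  Finset.prod_ne_zero_iff.2 fun i hi => h i (Finset.mem_range.1 hi)

theorem qPoch_eq_zero {x b : K} {k i : ℕ} (hi : i < k) (h : x * b ^ i = 1) : qPoch x b k = 0 :=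
  Finset.prod_eq_zero (Finset.mem_range.2 hi) (by rw [h, sub_self])

/-- The terminating `q`-binomial theorem. -/
theorem sum_qPoch_inv_pow_mul_pow {b : K} (hb : b ≠ 0) (z : K) (N : ℕ)
    (h : ∀ k, 1 ≤ k → k ≤ N → b ^ k ≠ 1) :
    ∑ k ∈ Finset.range (N + 1), qPoch ((b ^ N)⁻¹) b k / qPoch b b k * z ^ k
      = qPoch (z * (b ^ N)⁻¹) b N := by
  induction N with
  | zero => simp [qPoch]
  | succ N ih =>
    have hq : ∀ k ≤ N + 1, qPoch b b k ≠ 0 := fun k hk => qPoch_ne_zero fun i hi => by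
      have := h (i + 1) (by omega) (by omega)
      rw [← pow_succ']
      exact sub_ne_zero.2 this.symm
    have h1 : z * (b ^ (N + 1))⁻¹ * b = z * (b ^ N)⁻¹ := by
      rw [pow_succ]; field_simp
    rw [qPoch_succ', h1, ← ih fun k h1 h2 => h k h1 (by omega)]
    rw [Finset.sum_range_succ', sub_mul, one_mul, Finset.mul_sum,
      Finset.sum_range_succ' (fun k => qPoch ((b ^ N)⁻¹) b k / qPoch b b k * z ^ k) N]
    have h0 : qPoch ((b ^ N)⁻¹) b (N + 1) = 0 :=
      qPoch_eq_zero (Nat.lt_succ_self N) (inv_mul_cancel₀ (pow_ne_zero _ hb))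
    have h2 : ∑ k ∈ Finset.range N, qPoch ((b ^ N)⁻¹) b (k + 1) / qPoch b b (k + 1) * z ^ (k + 1)
        = ∑ k ∈ Finset.range (N + 1),
          qPoch ((b ^ N)⁻¹) b (k + 1) / qPoch b b (k + 1) * z ^ (k + 1) := by
      rw [Finset.sum_range_succ, h0]; simp
    rw [h2, add_sub_right_comm, ← Finset.sum_sub_distrib]
    simp only [qPoch_zero]
    congr 1
    refine Finset.sum_congr rfl fun k hk => ?_
    have hk' : k ≤ N := by have := Finset.mem_range.1 hk; omega
    have e1 : qPoch ((b ^ (N + 1))⁻¹) b (k + 1)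
        = (1 - (b ^ (N + 1))⁻¹) * qPoch ((b ^ N)⁻¹) b k := by
      rw [qPoch_succ']
      congr 2
      rw [pow_succ]; field_simp
    have hk1 := hq k (by omega)
    have hk2 : 1 - b * b ^ k ≠ 0 := fun h0 => hq (k + 1) (by omega) (by rw [qPoch_succ, h0, mul_zero])
    rw [e1, qPoch_succ, qPoch_succ]
    field_simp
    ring

open Polynomial in
/-- A terminating sum against a polynomial in `b ^ k` extracts its top coefficient. -/
theorem sum_qPoch_inv_pow_mul_eval {b : K} (hb : b ≠ 0) (N : ℕ)
    (h : ∀ k, 1 ≤ k → k ≤ N → b ^ k ≠ 1) (P : K[X]) (hP : P.natDegree ≤ N) :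
    ∑ k ∈ Finset.range (N + 1), qPoch ((b ^ N)⁻¹) b k / qPoch b b k * b ^ k * P.eval (b ^ k)
      = P.coeff N * qPoch b b N := by
  have h1 : ∀ k, P.eval (b ^ k) = ∑ j ∈ Finset.range (N + 1), P.coeff j * (b ^ k) ^ j := fun k =>
    eval_eq_sum_range' (by omega) _
  simp only [h1, Finset.mul_sum]
  rw [Finset.sum_comm]
  have h2 : ∀ j ∈ Finset.range (N + 1), ∑ k ∈ Finset.range (N + 1),
      qPoch ((b ^ N)⁻¹) b k / qPoch b b k * b ^ k * (P.coeff j * (b ^ k) ^ j)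
        = P.coeff j * qPoch (b ^ (j + 1) * (b ^ N)⁻¹) b N := by
    intro j _
    rw [← sum_qPoch_inv_pow_mul_pow hb _ N h, Finset.mul_sum]
    refine Finset.sum_congr rfl fun k _ => ?_
    rw [← pow_mul, ← pow_mul]
    ring
  rw [Finset.sum_congr rfl h2, Finset.sum_range_succ, Finset.sum_eq_zero, zero_add]
  · rw [pow_succ']
    rw [mul_assoc, mul_inv_cancel₀ (pow_ne_zero _ hb), mul_one]
  · intro j hj
    have hj := Finset.mem_range.1 hj
    rw [qPoch_eq_zero (i := N - (j + 1)) (by omega), mul_zero]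
    rw [mul_right_comm, ← pow_add, show j + 1 + (N - (j + 1)) = N by omega]
    exact mul_inv_cancel₀ (pow_ne_zero _ hb)

open Polynomial in
/-- The `q`-shifted factorial `(x X; b)_m` as a polynomial in `X`. -/
def qPochPoly (x b : K) (m : ℕ) : K[X] :=
  ∏ j ∈ Finset.range m, (1 - C (x * b ^ j) * X)

theorem eval_qPochPoly (x b z : K) (m : ℕ) : (qPochPoly x b m).eval z = qPoch (x * z) b m := by
  simp only [qPochPoly, qPoch, Polynomial.eval_prod]
  refine Finset.prod_congr rfl fun i _ => ?_
  simp
  ring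

theorem natDegree_qPochPoly_le (x b : K) (m : ℕ) : (qPochPoly x b m).natDegree ≤ m := by
  refine (Polynomial.natDegree_prod_le _ _).trans ?_
  refine (Finset.sum_le_sum (g := fun _ => 1) fun i _ => ?_).trans (by simp)
  compute_degree

theorem coeff_qPochPoly (x b : K) (m : ℕ) :
    (qPochPoly x b m).coeff m = (-x) ^ m * b ^ m.choose 2 := by
  induction m with
  | zero => simp [qPochPoly]
  | succ m ih =>
    have : qPochPoly x b (m + 1)
        = qPochPoly x b m * (1 - Polynomial.C (x * b ^ m) * Polynomial.X) := by
      simp [qPochPoly, Finset.prod_range_succ]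
    rw [this, Polynomial.coeff_mul_add_eq_of_natDegree_le (natDegree_qPochPoly_le x b m)
      (by compute_degree), ih, Nat.choose_succ_succ' m 1, Nat.choose_one_right]
    have h1 (c : K) : (1 - Polynomial.C c * Polynomial.X).coeff 1 = -c := by
      simp [Polynomial.coeff_one]
    rw [h1]
    ring

theorem qPoch_shift_div {x b : K} {m k : ℕ} (hm : qPoch x b m ≠ 0) (hk : qPoch x b k ≠ 0) :
    qPoch (x * b ^ m) b k / qPoch x b k = (qPochPoly x b m).eval (b ^ k) / qPoch x b m := by
  rw [eval_qPochPoly, div_eq_div_iff hk hm, mul_comm, qPoch_mul_qPoch_comm, mul_comm]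

end Summation

section Congruence

variable {K : Type*} [Field K] {O : Subring K} {t : K}

/-- Congruence modulo `t ^ 2` of two elements of the subring `O`. -/
def CongrSq (O : Subring K) (t f g : K) : Prop :=
  f ∈ O ∧ g ∈ O ∧ ∃ h ∈ O, f - g = t ^ 2 * h

/-- `x` is a unit of the subring `O`. -/
def IsUnitIn (O : Subring K) (x : K) : Prop := x ∈ O ∧ x⁻¹ ∈ O ∧ x ≠ 0

theorem IsUnitIn.mul {x y : K} (hx : IsUnitIn O x) (hy : IsUnitIn O y) : IsUnitIn O (x * y) :=
  ⟨O.mul_mem hx.1 hy.1, by rw [mul_inv]; exact O.mul_mem hx.2.1 hy.2.1, mul_ne_zero hx.2.2 hy.2.2⟩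

theorem IsUnitIn.one : IsUnitIn O (1 : K) := ⟨O.one_mem, by simp [O.one_mem], one_ne_zero⟩

theorem IsUnitIn.neg {x : K} (hx : IsUnitIn O x) : IsUnitIn O (-x) :=
  ⟨O.neg_mem hx.1, by rw [inv_neg]; exact O.neg_mem hx.2.1, neg_ne_zero.2 hx.2.2⟩

theorem IsUnitIn.inv {x : K} (hx : IsUnitIn O x) : IsUnitIn O x⁻¹ :=
  ⟨hx.2.1, by rw [inv_inv]; exact hx.1, inv_ne_zero hx.2.2⟩

theorem IsUnitIn.pow {x : K} (hx : IsUnitIn O x) (k : ℕ) : IsUnitIn O (x ^ k) := by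
  induction k with
  | zero => simpa using IsUnitIn.one
  | succ k ih => rw [pow_succ]; exact ih.mul hx

theorem IsUnitIn.zpow {x : K} (hx : IsUnitIn O x) (k : ℤ) : IsUnitIn O (x ^ k) := by
  cases k with
  | ofNat k => simpa using hx.pow k
  | negSucc k => rw [zpow_negSucc]; exact (hx.pow _).inv

theorem IsUnitIn.prod {ι : Type*} {s : Finset ι} {f : ι → K} (h : ∀ i ∈ s, IsUnitIn O (f i)) :
    IsUnitIn O (∏ i ∈ s, f i) :=
  Finset.prod_induction _ (IsUnitIn O) (fun _ _ => IsUnitIn.mul) IsUnitIn.one h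

namespace CongrSq

theorem refl {f : K} (hf : f ∈ O) : CongrSq O t f f := ⟨hf, hf, 0, O.zero_mem, by ring⟩

theorem symm {f g : K} (h : CongrSq O t f g) : CongrSq O t g f := by
  obtain ⟨hf, hg, c, hc, e⟩ := h
  exact ⟨hg, hf, -c, O.neg_mem hc, by linear_combination -e⟩

theorem trans {f g h : K} (h1 : CongrSq O t f g) (h2 : CongrSq O t g h) : CongrSq O t f h := by
  obtain ⟨hf, _, c, hc, e⟩ := h1
  obtain ⟨_, hg, c', hc', e'⟩ := h2
  exact ⟨hf, hg, c + c', O.add_mem hc hc', by linear_combination e + e'⟩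

theorem add {f g f' g' : K} (h1 : CongrSq O t f g) (h2 : CongrSq O t f' g') :
    CongrSq O t (f + f') (g + g') := by
  obtain ⟨hf, hg, c, hc, e⟩ := h1
  obtain ⟨hf', hg', c', hc', e'⟩ := h2
  exact ⟨O.add_mem hf hf', O.add_mem hg hg', c + c', O.add_mem hc hc',
    by linear_combination e + e'⟩

theorem mul {f g f' g' : K} (h1 : CongrSq O t f g) (h2 : CongrSq O t f' g') :
    CongrSq O t (f * f') (g * g') := by
  obtain ⟨hf, hg, c, hc, e⟩ := h1
  obtain ⟨hf', hg', c', hc', e'⟩ := h2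
  exact ⟨O.mul_mem hf hf', O.mul_mem hg hg', c * f' + g * c',
    O.add_mem (O.mul_mem hc hf') (O.mul_mem hg hc'), by linear_combination f' * e + g * e'⟩

theorem pow {f g : K} (h : CongrSq O t f g) (k : ℕ) : CongrSq O t (f ^ k) (g ^ k) := by
  induction k with
  | zero => simpa using refl O.one_mem
  | succ k ih => rw [pow_succ, pow_succ]; exact ih.mul h

theorem sum {ι : Type*} {s : Finset ι} {f g : ι → K} (h : ∀ i ∈ s, CongrSq O t (f i) (g i)) :
    CongrSq O t (∑ i ∈ s, f i) (∑ i ∈ s, g i) := by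
  classical
  induction s using Finset.induction_on with
  | empty => simpa using refl O.zero_mem
  | insert a s ha ih =>
    rw [Finset.sum_insert ha, Finset.sum_insert ha]
    exact (h a (Finset.mem_insert_self a s)).add
      (ih fun i hi => h i (Finset.mem_insert_of_mem hi))

theorem prod {ι : Type*} {s : Finset ι} {f g : ι → K} (h : ∀ i ∈ s, CongrSq O t (f i) (g i)) :
    CongrSq O t (∏ i ∈ s, f i) (∏ i ∈ s, g i) := by
  classical
  induction s using Finset.induction_on with
  | empty => simpa using refl O.one_mem
  | insert a s ha ih =>
    rw [Finset.prod_insert ha, Finset.prod_insert ha]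
    exact (h a (Finset.mem_insert_self a s)).mul
      (ih fun i hi => h i (Finset.mem_insert_of_mem hi))

theorem inv {f g : K} (h : CongrSq O t f g) (hf : IsUnitIn O f) (hg : IsUnitIn O g) :
    CongrSq O t f⁻¹ g⁻¹ := by
  obtain ⟨_, _, c, hc, e⟩ := h
  refine ⟨hf.2.1, hg.2.1, -(c * f⁻¹ * g⁻¹),
    O.neg_mem (O.mul_mem (O.mul_mem hc hf.2.1) hg.2.1), ?_⟩
  have h1 := hf.2.2
  have h2 := hg.2.2
  field_simp
  linear_combination -e

theorem div {f g f' g' : K} (h : CongrSq O t f g) (h' : CongrSq O t f' g') (hf : IsUnitIn O f')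
    (hg : IsUnitIn O g') : CongrSq O t (f / f') (g / g') := by
  rw [div_eq_mul_inv, div_eq_mul_inv]
  exact h.mul (h'.inv hf hg)

end CongrSq

theorem congrSq_one_sub_mul_one_sub_inv {c u : K} (hc : c ∈ O) (hu : IsUnitIn O u) (k : ℕ) :
    CongrSq O (u - 1) ((1 - c * (u ^ k)⁻¹) * (1 - c * u ^ k)) ((1 - c) * (1 - c)) := by
  have huk := hu.pow k
  have h1 : ∀ x ∈ O, 1 - c * x ∈ O := fun x hx => O.sub_mem O.one_mem (O.mul_mem hc hx)
  have h2 := O.sub_mem O.one_mem hc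
  refine ⟨O.mul_mem (h1 _ huk.2.1) (h1 _ huk.1), O.mul_mem h2 h2,
    -(c * (∑ i ∈ Finset.range k, u ^ i) ^ 2 * (u ^ k)⁻¹),
    O.neg_mem (O.mul_mem (O.mul_mem hc (O.pow_mem (O.sum_mem fun i _ => (hu.pow i).1) 2))
      huk.2.1), ?_⟩
  have e := geom_sum_mul u k
  have hne := huk.2.2
  have : (u - 1) ^ 2 * -(c * (∑ i ∈ Finset.range k, u ^ i) ^ 2 * (u ^ k)⁻¹)
    = -(c * (u ^ k - 1) ^ 2 * (u ^ k)⁻¹) := by rw [← e]; ring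
  rw [this]
  field_simp
  ring

theorem congrSq_one_sub_mul_pow {c u : K} (hc : c ∈ O) (hu : IsUnitIn O u) (k : ℕ) :
    CongrSq O (u - 1) ((1 - c * u ^ k) * (1 - c * u⁻¹) ^ k) ((1 - c) ^ (k + 1)) := by
  have h2 := O.sub_mem O.one_mem hc
  have h1 : ∀ x ∈ O, 1 - c * x ∈ O := fun x hx => O.sub_mem O.one_mem (O.mul_mem hc hx)
  induction k with
  | zero => simpa using CongrSq.refl h2
  | succ k ih =>
    have h3 : CongrSq O (u - 1) ((1 - c * u ^ (k + 1)) * (1 - c * u⁻¹))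
        ((1 - c * u ^ k) * (1 - c)) := by
      refine ⟨O.mul_mem (h1 _ (hu.pow _).1) (h1 _ hu.2.1), O.mul_mem (h1 _ (hu.pow _).1) h2,
        -(c * (∑ i ∈ Finset.range (k + 1), u ^ i) * u⁻¹),
        O.neg_mem (O.mul_mem (O.mul_mem hc (O.sum_mem fun i _ => (hu.pow i).1)) hu.2.1), ?_⟩
      have e := geom_sum_mul u (k + 1)
      have hne := hu.2.2
      have : (u - 1) ^ 2 * -(c * (∑ i ∈ Finset.range (k + 1), u ^ i) * u⁻¹)
        = -(c * (u - 1) * (u ^ (k + 1) - 1) * u⁻¹) := by rw [← e]; ring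
      rw [this]
      field_simp
      ring
    have h4 := h3.mul (CongrSq.refl (t := u - 1) (O.pow_mem (h1 _ hu.2.1) k))
    have h5 := ih.mul (CongrSq.refl (t := u - 1) h2)
    rw [mul_right_comm] at h4
    rw [pow_succ' (1 - c * u⁻¹), ← mul_assoc, pow_succ (1 - c) (k + 1)]
    rw [mul_right_comm] at h4
    exact h4.trans (by rwa [mul_right_comm] at h5)

/-- The values `f₁, f₀, f₂` at `u, 1, u⁻¹` agree with those of an affine function of `u`,
modulo `(u - 1) ^ 2`. -/
def IsAffineSq (O : Subring K) (t f₁ f₀ f₂ : K) : Prop :=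
  ∃ g ∈ O, CongrSq O t f₁ (f₀ + g * t) ∧ CongrSq O t f₂ (f₀ - g * t) ∧ f₀ ∈ O ∧ t ∈ O

theorem IsAffineSq.mul {f₁ f₀ f₂ g₁ g₀ g₂ : K} (hf : IsAffineSq O t f₁ f₀ f₂)
    (hg : IsAffineSq O t g₁ g₀ g₂) : IsAffineSq O t (f₁ * g₁) (f₀ * g₀) (f₂ * g₂) := by
  obtain ⟨a, ha, h1, h2, h0, ht⟩ := hf
  obtain ⟨b, hb, h1', h2', h0', _⟩ := hg
  have key : a * g₀ + f₀ * b ∈ O := O.add_mem (O.mul_mem ha h0') (O.mul_mem h0 hb)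
  have hab := O.mul_mem ha hb
  refine ⟨a * g₀ + f₀ * b, key, (h1.mul h1').trans ⟨(h1.mul h1').2.1,
    O.add_mem (O.mul_mem h0 h0') (O.mul_mem key ht), a * b, hab, by ring⟩,
    (h2.mul h2').trans ⟨(h2.mul h2').2.1,
    O.sub_mem (O.mul_mem h0 h0') (O.mul_mem key ht), a * b, hab, by ring⟩, O.mul_mem h0 h0', ht⟩

theorem IsAffineSq.prod {ι : Type*} {s : Finset ι} {f₁ f₀ f₂ : ι → K} (ht : t ∈ O)
    (h : ∀ i ∈ s, IsAffineSq O t (f₁ i) (f₀ i) (f₂ i)) :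
    IsAffineSq O t (∏ i ∈ s, f₁ i) (∏ i ∈ s, f₀ i) (∏ i ∈ s, f₂ i) := by
  classical
  induction s using Finset.induction_on with
  | empty => exact ⟨0, O.zero_mem, by simpa using CongrSq.refl O.one_mem,
      by simpa using CongrSq.refl O.one_mem, by simp [O.one_mem], ht⟩
  | insert a s ha ih =>
    rw [Finset.prod_insert ha, Finset.prod_insert ha, Finset.prod_insert ha]
    exact (h a (Finset.mem_insert_self a s)).mul
      (ih fun i hi => h i (Finset.mem_insert_of_mem hi))

theorem isAffineSq_one_sub_mul {c u : K} (hc : c ∈ O) (hu : IsUnitIn O u) :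
    IsAffineSq O (u - 1) (1 - c * u) (1 - c) (1 - c * u⁻¹) := by
  have ht := O.sub_mem hu.1 O.one_mem
  have h2 := O.sub_mem O.one_mem hc
  have h1 : ∀ x ∈ O, 1 - c * x ∈ O := fun x hx => O.sub_mem O.one_mem (O.mul_mem hc hx)
  have hne := hu.2.2
  refine ⟨-c, O.neg_mem hc, ⟨h1 _ hu.1, O.add_mem h2 (O.mul_mem (O.neg_mem hc) ht), 0, O.zero_mem,
    by ring⟩, ⟨h1 _ hu.2.1, O.sub_mem h2 (O.mul_mem (O.neg_mem hc) ht), -(c * u⁻¹),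
    O.neg_mem (O.mul_mem hc hu.2.1), ?_⟩, h2, ht⟩
  field_simp
  ring

theorem isAffineSq_one_sub_mul_inv {c u : K} (hc : c ∈ O) (hu : IsUnitIn O u) :
    IsAffineSq O (u - 1) (1 - c * u⁻¹) (1 - c) (1 - c * u) := by
  obtain ⟨g, hg, h1, h2, h3⟩ := isAffineSq_one_sub_mul hc hu
  exact ⟨-g, O.neg_mem hg, by simpa [sub_eq_add_neg] using h2, by simpa using h1, h3⟩

theorem IsAffineSq.add_congrSq {f₁ f₀ f₂ : K} (h : IsAffineSq O t f₁ f₀ f₂) :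
    CongrSq O t (2 * f₀) (f₁ + f₂) := by
  obtain ⟨g, hg, h1, h2, h0, ht⟩ := h
  have := (h1.add h2).symm
  rwa [show f₀ + g * t + (f₀ - g * t) = 2 * f₀ by ring] at this

end Congruence

section Localization

open Polynomial

/-- The local ring of `ℚ(q)` at the prime `Φ_n(q)`. -/
def cyclotomicLocal (n : ℕ) : Subring (RatFunc ℚ) where
  carrier := {f | ∃ A B : ℚ[X], IsCoprime B (cyclotomic n ℚ) ∧ B ≠ 0 ∧
    f * algebraMap ℚ[X] (RatFunc ℚ) B = algebraMap ℚ[X] (RatFunc ℚ) A}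
  mul_mem' := by
    rintro f g ⟨A, B, h, h0, e⟩ ⟨A', B', h', h0', e'⟩
    refine ⟨A * A', B * B', h.mul_left h', mul_ne_zero h0 h0', ?_⟩
    rw [map_mul, map_mul, ← e, ← e']; ring
  one_mem' := ⟨1, 1, isCoprime_one_left, one_ne_zero, by simp⟩
  add_mem' := by
    rintro f g ⟨A, B, h, h0, e⟩ ⟨A', B', h', h0', e'⟩
    refine ⟨A * B' + A' * B, B * B', h.mul_left h', mul_ne_zero h0 h0', ?_⟩
    rw [map_add, map_mul, map_mul, map_mul, ← e, ← e']; ring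
  zero_mem' := ⟨0, 1, isCoprime_one_left, one_ne_zero, by simp⟩
  neg_mem' := by
    rintro f ⟨A, B, h, h0, e⟩
    exact ⟨-A, B, h, h0, by rw [map_neg, ← e]; ring⟩

theorem algebraMap_mem_cyclotomicLocal (n : ℕ) (A : ℚ[X]) :
    algebraMap ℚ[X] (RatFunc ℚ) A ∈ cyclotomicLocal n :=
  ⟨A, 1, isCoprime_one_left, one_ne_zero, by simp⟩

theorem isUnitIn_algebraMap {n : ℕ} {A : ℚ[X]} (hA : A ≠ 0)
    (h : IsCoprime A (cyclotomic n ℚ)) :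
    IsUnitIn (cyclotomicLocal n) (algebraMap ℚ[X] (RatFunc ℚ) A) := by
  have h0 : algebraMap ℚ[X] (RatFunc ℚ) A ≠ 0 := by simpa using hA
  exact ⟨algebraMap_mem_cyclotomicLocal n A, ⟨1, A, h, hA, by simp [inv_mul_cancel₀ h0]⟩, h0⟩

theorem isUnitIn_q {n : ℕ} (hn : 0 < n) : IsUnitIn (cyclotomicLocal n) q := by
  rw [q, ← RatFunc.algebraMap_X]
  refine isUnitIn_algebraMap X_ne_zero ?_
  obtain ⟨c, hc⟩ := cyclotomic.dvd_X_pow_sub_one n ℚ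
  refine IsCoprime.of_isCoprime_of_dvd_right (y := X ^ n - 1) ⟨X ^ (n - 1), -1, ?_⟩ ⟨c, hc⟩
  rw [← pow_succ, Nat.sub_add_cancel hn]; ring

theorem isCoprime_X_pow_sub_one_cyclotomic {n e : ℕ} (hn : 0 < n) (he : ¬ n ∣ e) :
    IsCoprime (X ^ e - 1 : ℚ[X]) (cyclotomic n ℚ) := by
  refine ((cyclotomic.irreducible_rat hn).coprime_iff_not_dvd.2 fun hdvd => he ?_).symm
  have hζ := Complex.isPrimitiveRoot_exp n hn.ne'
  obtain ⟨c, hc⟩ := hdvd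
  have h1 : aeval (Complex.exp (2 * Real.pi * Complex.I / n)) (cyclotomic n ℚ) = 0 := by
    have h2 := hζ.isRoot_cyclotomic hn
    rw [IsRoot.def, ← map_cyclotomic n (algebraMap ℚ ℂ), eval_map_algebraMap] at h2
    exact h2
  have h3 := congrArg (aeval (Complex.exp (2 * Real.pi * Complex.I / n))) hc
  rw [map_mul, h1, zero_mul] at h3
  simp only [map_sub, map_pow, aeval_X, map_one] at h3
  exact (hζ.pow_eq_one_iff_dvd e).1 (sub_eq_zero.1 h3)

theorem isUnitIn_one_sub_q_zpow {n : ℕ} (hn : 0 < n) {e : ℤ} (he : ¬ (n : ℤ) ∣ e) :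
    IsUnitIn (cyclotomicLocal n) (1 - q ^ e) := by
  have key : ∀ k : ℕ, ¬ n ∣ k → IsUnitIn (cyclotomicLocal n) (1 - q ^ k) := by
    intro k hk
    have h0 : (X ^ k - 1 : ℚ[X]) ≠ 0 :=
      X_pow_sub_C_ne_zero (Nat.pos_of_ne_zero fun h => hk (by simp [h])) 1
    have := (isUnitIn_algebraMap h0 (isCoprime_X_pow_sub_one_cyclotomic hn hk)).neg
    simpa [RatFunc.algebraMap_X] using this
  obtain ⟨k, rfl | rfl⟩ := e.eq_nat_or_neg
  · rw [zpow_natCast]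
    exact key k fun h => he (Int.natCast_dvd_natCast.2 h)
  · have hq := isUnitIn_q hn
    have := (hq.pow k).inv.mul (key k fun h => he (by simpa using Int.natCast_dvd_natCast.2 h)).neg
    convert this using 1
    have := (hq.pow k).2.2
    rw [zpow_neg, zpow_natCast]
    field_simp
    ring

theorem congrMod_of_congrSq {n : ℕ} {f g : RatFunc ℚ}
    (h : CongrSq (cyclotomicLocal n) (q ^ n - 1) f g) :
    CongrMod (cyclotomic n ℚ ^ 2) f g := by
  obtain ⟨_, _, c, ⟨A, B, hB, hB0, e⟩, hfg⟩ := h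
  obtain ⟨D, hD⟩ := cyclotomic.dvd_X_pow_sub_one n ℚ
  refine ⟨D ^ 2 * A, B, hB.pow_right, ?_⟩
  have h0 : algebraMap ℚ[X] (RatFunc ℚ) B ≠ 0 := by simpa using hB0
  have h1 : (q ^ n - 1 : RatFunc ℚ) = algebraMap ℚ[X] (RatFunc ℚ) (cyclotomic n ℚ * D) := by
    rw [← hD]; simp [RatFunc.algebraMap_X]
  rw [eq_div_iff h0, hfg, mul_assoc, e, h1]
  simp only [map_mul, map_pow]
  ring

end Localization

section KarlssonMinton

variable {K : Type*} [Field K]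

open Polynomial in
theorem natDegree_prod_pow_le_and_coeff {ι : Type*} (s : Finset ι) (P : ι → K[X]) (m w : ι → ℕ)
    (h : ∀ i ∈ s, (P i).natDegree ≤ m i) :
    (∏ i ∈ s, P i ^ w i).natDegree ≤ ∑ i ∈ s, w i * m i ∧
      (∏ i ∈ s, P i ^ w i).coeff (∑ i ∈ s, w i * m i) = ∏ i ∈ s, (P i).coeff (m i) ^ w i := by
  classical
  induction s using Finset.induction_on with
  | empty => simp
  | insert a s ha ih =>
    obtain ⟨h1, h2⟩ := ih fun i hi => h i (Finset.mem_insert_of_mem hi)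
    have h3 := h a (Finset.mem_insert_self a s)
    have h4 : (P a ^ w a).natDegree ≤ w a * m a := natDegree_pow_le_of_le _ h3
    rw [Finset.prod_insert ha, Finset.prod_insert ha, Finset.sum_insert ha]
    refine ⟨natDegree_mul_le_of_le h4 h1, ?_⟩
    rw [coeff_mul_add_eq_of_natDegree_le h4 h1, h2, coeff_pow_of_natDegree_le h3]

/-- Gasper's terminating `q`-Karlsson–Minton summation, with multiplicities `w i`. -/
theorem sum_qPoch_karlsson_minton {ι : Type*} (s : Finset ι) {b : K} (hb : b ≠ 0)
    (x : ι → K) (m w : ι → ℕ) {N : ℕ} (hN : N = ∑ i ∈ s, w i * m i)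
    (h : ∀ k, 1 ≤ k → k ≤ N → b ^ k ≠ 1)
    (hm : ∀ i ∈ s, qPoch (x i) b (m i) ≠ 0)
    (hx : ∀ i ∈ s, ∀ k ≤ N, qPoch (x i) b k ≠ 0) :
    ∑ k ∈ Finset.range (N + 1), qPoch ((b ^ N)⁻¹) b k / qPoch b b k * b ^ k *
        ∏ i ∈ s, (qPoch (x i * b ^ m i) b k / qPoch (x i) b k) ^ w i
      = qPoch b b N * ∏ i ∈ s, ((-x i) ^ m i * b ^ (m i).choose 2 / qPoch (x i) b (m i)) ^ w i := by
  obtain ⟨h1, h2⟩ := natDegree_prod_pow_le_and_coeff s (fun i => qPochPoly (x i) b (m i)) m w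
    fun i _ => natDegree_qPochPoly_le _ _ _
  rw [← hN] at h1 h2
  have h3 := sum_qPoch_inv_pow_mul_eval hb N h _ h1
  rw [h2] at h3
  have h4 : ∀ k ∈ Finset.range (N + 1), qPoch ((b ^ N)⁻¹) b k / qPoch b b k * b ^ k *
        ∏ i ∈ s, (qPoch (x i * b ^ m i) b k / qPoch (x i) b k) ^ w i
      = qPoch ((b ^ N)⁻¹) b k / qPoch b b k * b ^ k *
        (∏ i ∈ s, qPochPoly (x i) b (m i) ^ w i).eval (b ^ k) /
          ∏ i ∈ s, qPoch (x i) b (m i) ^ w i := by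
    intro k hk
    rw [mul_div_assoc, Polynomial.eval_prod, ← Finset.prod_div_distrib]
    congr 1
    refine Finset.prod_congr rfl fun i hi => ?_
    rw [qPoch_shift_div (hm i hi) (hx i hi k (by have := Finset.mem_range.1 hk; omega)),
      Polynomial.eval_pow, div_pow]
  rw [Finset.sum_congr rfl h4, ← Finset.sum_div, h3, mul_comm, mul_div_assoc,
    ← Finset.prod_div_distrib]
  congr 1
  refine Finset.prod_congr rfl fun i _ => ?_
  rw [coeff_qPochPoly, div_pow]

end KarlssonMinton

section QPochCongruence

variable {K : Type*} [Field K] {O : Subring K}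

theorem qPoch_mem {x b : K} (hx : x ∈ O) (hb : b ∈ O) (k : ℕ) : qPoch x b k ∈ O :=
  O.prod_mem fun _ _ => O.sub_mem O.one_mem (O.mul_mem hx (O.pow_mem hb _))

theorem congrSq_qPoch_mul_qPoch_inv {b c u : K} (hb : b ∈ O) (hc : c ∈ O) (hu : IsUnitIn O u)
    (k j : ℕ) : CongrSq O (u - 1) (qPoch (c * (u ^ k)⁻¹) b j * qPoch (c * u ^ k) b j)
      (qPoch c b j * qPoch c b j) := by
  simp only [qPoch, ← Finset.prod_mul_distrib]
  refine CongrSq.prod fun i _ => ?_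
  rw [mul_right_comm c (u ^ k), mul_right_comm c (u ^ k)⁻¹]
  exact congrSq_one_sub_mul_one_sub_inv (O.mul_mem hc (O.pow_mem hb i)) hu k

theorem congrSq_qPoch_mul_qPoch_pow {b c u : K} (hb : b ∈ O) (hc : c ∈ O) (hu : IsUnitIn O u)
    (k j : ℕ) : CongrSq O (u - 1) (qPoch (c * u ^ k) b j * qPoch (c * u⁻¹) b j ^ k)
      (qPoch c b j ^ (k + 1)) := by
  simp only [qPoch, ← Finset.prod_pow, ← Finset.prod_mul_distrib]
  refine CongrSq.prod fun i _ => ?_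
  rw [mul_right_comm c (u ^ k), mul_right_comm c u⁻¹]
  exact congrSq_one_sub_mul_pow (O.mul_mem hc (O.pow_mem hb i)) hu k

end QPochCongruence

theorem isUnitIn_qPoch {n d : ℕ} (hn : 0 < n) {a : ℤ} {k : ℕ}
    (h : ∀ i < k, ¬ (n : ℤ) ∣ a + d * i) :
    IsUnitIn (cyclotomicLocal n) (qPoch (q ^ a) (q ^ d) k) := by
  refine IsUnitIn.prod fun i hi => ?_
  have := isUnitIn_one_sub_q_zpow hn (h i (Finset.mem_range.1 hi))
  rwa [zpow_add₀ RatFunc.X_ne_zero, zpow_mul, zpow_natCast, zpow_natCast] at this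

theorem not_dvd_add_mul {n d : ℕ} (h : Nat.Coprime n d) (y : ℤ) {i : ℕ} (hi : i + 1 < n) :
    ¬ (n : ℤ) ∣ (d + n * y) + d * i := by
  intro hdvd
  have h1 : (n : ℤ) ∣ ((d * (i + 1) : ℕ) : ℤ) := by
    have h3 := dvd_sub hdvd (Dvd.intro y rfl)
    have h4 : ((d * (i + 1) : ℕ) : ℤ) = d + n * y + d * i - n * y := by push_cast; ring
    rwa [h4]
  have h2 := Nat.le_of_dvd (by omega) (h.dvd_of_dvd_mul_left (Int.natCast_dvd_natCast.1 h1))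
  omega

theorem isUnitIn_qPoch_shift {n d : ℕ} (h : Nat.Coprime n d) (y : ℤ) {k : ℕ} (hk : k < n) :
    IsUnitIn (cyclotomicLocal n) (qPoch (q ^ ((d : ℤ) + n * y)) (q ^ d) k) :=
  isUnitIn_qPoch (by omega) fun _ _ => not_dvd_add_mul h y (by omega)

theorem isUnitIn_qPoch_self {n d : ℕ} (h : Nat.Coprime n d) {k : ℕ} (hk : k < n) :
    IsUnitIn (cyclotomicLocal n) (qPoch (q ^ d) (q ^ d) k) := by
  simpa using isUnitIn_qPoch_shift h 0 hk

theorem neg_zpow_pow_mul (a : ℤ) (d m c : ℕ) :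
    (-(q ^ a)) ^ m * (q ^ d) ^ c = (-1) ^ m * q ^ (a * m + d * c) := by
  have hq : q ≠ 0 := RatFunc.X_ne_zero
  rw [neg_pow, zpow_add₀ hq, zpow_mul, zpow_mul, zpow_natCast, zpow_natCast, zpow_natCast,
    mul_assoc]

theorem neg_one_pow_mul_zpow_pow (m : ℕ) (x : ℤ) (e : ℕ) :
    ((-1) ^ m * q ^ x) ^ e = (-1) ^ (e * m) * q ^ (x * e) := by
  rw [mul_pow, ← pow_mul, zpow_mul, zpow_natCast, mul_comm m]

theorem q_zpow_mul_pow (a : ℤ) (d m : ℕ) : q ^ a * (q ^ d) ^ m = q ^ (a + d * m) := by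
  rw [zpow_add₀ RatFunc.X_ne_zero, zpow_mul, zpow_natCast, zpow_natCast]

theorem q_pow_ne_one {n d k : ℕ} (h : Nat.Coprime n d) (hk : 1 ≤ k) (hkn : k < n) :
    ((q ^ d) ^ k : RatFunc ℚ) ≠ 1 := by
  intro h1
  obtain ⟨k, rfl⟩ := Nat.exists_eq_succ_of_ne_zero (by omega : k ≠ 0)
  have h2 := (isUnitIn_one_sub_q_zpow (by omega) (not_dvd_add_mul h 0 hkn)).2.2
  refine h2 ?_
  rw [sub_eq_zero, ← h1, ← pow_mul, ← zpow_natCast]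
  congr 1
  push_cast; ring

theorem exponent_eq {d r n p e s : ℕ} (hd : d = s + e + 3) (hr : r = s + 1)
    (hn : n + r = d * (p + 2)) :
    (((d : ℤ) + n * (d - 2)) * (p + 2 : ℕ) + d * ((p + 2).choose 2 : ℕ)
      + (((d : ℤ) + n * (-1)) * (p + 2 : ℕ) + d * ((p + 2).choose 2 : ℕ)) * e
      + (((d : ℤ) + n * (-1)) * (p + 1 : ℕ) + d * ((p + 1).choose 2 : ℕ)) * s
      + (((d : ℤ) + n * (-1)) * (p : ℕ) + d * (p.choose 2 : ℕ)) * 1) + (r - d)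
    = expA d n r := by
  have h1 : (d : ℤ) ∣ n + r := ⟨p + 2, by exact_mod_cast hn⟩
  have h0 : (d : ℤ) ≠ 0 := by omega
  have h0' : ((d : ℤ) : ℚ) ≠ 0 := by exact_mod_cast h0
  have hn' : (n : ℚ) = d * (p + 2) - r := by
    rw [eq_sub_iff_add_eq]; exact_mod_cast hn
  rw [← Int.cast_inj (α := ℚ), expA_cast h0 h1]
  push_cast at h0' ⊢
  rw [Nat.cast_choose_two, Nat.cast_choose_two, Nat.cast_choose_two, hn']
  push_cast
  field_simp
  have e1 : (d : ℚ) = s + e + 3 := by rw [hd]; push_cast; ring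
  have e2 : (r : ℚ) = s + 1 := by rw [hr]; push_cast; ring
  rw [e1, e2]
  ring

/-- The summand of the deformed series to which the Karlsson–Minton summation applies. -/
def deformedTerm (d r n s e k : ℕ) : RatFunc ℚ :=
  qPoch (q ^ ((d : ℤ) + r) * ((q ^ n) ^ (d - 1))⁻¹) (q ^ d) k
    * qPoch (q ^ ((d : ℤ) + r) * (q ^ n) ^ (d - 1)) (q ^ d) k
    * (qPoch (q ^ ((d : ℤ) + r)) (q ^ d) k ^ e * qPoch (q ^ (r : ℤ)) (q ^ d) k ^ s
      * qPoch (q ^ ((r : ℤ) - d)) (q ^ d) k * q ^ (d * k))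
    / (qPoch (q ^ d) (q ^ d) k *
      (qPoch (q ^ d * (q ^ n) ^ (s + e + 1)) (q ^ d) k
        * qPoch (q ^ d * (q ^ n)⁻¹) (q ^ d) k ^ (s + e + 1)))

variable {d r n p e s : ℕ}

theorem isUnitIn_qPoch_shift_pow (h : Nat.Coprime n d) (y : ℕ) {k : ℕ} (hk : k < n) :
    IsUnitIn (cyclotomicLocal n) (qPoch (q ^ d * (q ^ n) ^ y) (q ^ d) k) := by
  convert isUnitIn_qPoch_shift h y hk using 2
  rw [zpow_add₀ RatFunc.X_ne_zero, zpow_mul, zpow_natCast, zpow_natCast, zpow_natCast]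

theorem isUnitIn_qPoch_shift_inv (h : Nat.Coprime n d) {k : ℕ} (hk : k < n) :
    IsUnitIn (cyclotomicLocal n) (qPoch (q ^ d * (q ^ n)⁻¹) (q ^ d) k) := by
  convert isUnitIn_qPoch_shift h (-1) hk using 2
  rw [zpow_add₀ RatFunc.X_ne_zero, zpow_mul, zpow_natCast, zpow_natCast, zpow_neg_one]

theorem congrSq_deformedTerm (h : Nat.Coprime n d) {k : ℕ} (hk : k < n) :
    CongrSq (cyclotomicLocal n) (q ^ n - 1)
      (qPoch (q ^ ((d : ℤ) + r)) (q ^ d) k ^ (e + 2) * qPoch (q ^ (r : ℤ)) (q ^ d) k ^ s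
        * qPoch (q ^ ((r : ℤ) - d)) (q ^ d) k * q ^ (d * k) / qPoch (q ^ d) (q ^ d) k ^ (s + e + 3))
      (deformedTerm d r n s e k) := by
  have hn : 0 < n := by omega
  have hq := isUnitIn_q hn
  have hQ := hq.pow d
  have hu := hq.pow n
  have hA := hq.zpow ((d : ℤ) + r)
  have mem (a : ℤ) : qPoch (q ^ a) (q ^ d) k ∈ cyclotomicLocal n := qPoch_mem (hq.zpow a).1 hQ.1 k
  have h1 := (congrSq_qPoch_mul_qPoch_inv hQ.1 hA.1 hu (d - 1) k).symm
  have hD := isUnitIn_qPoch_self h hk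
  have h2 := (CongrSq.refl (t := q ^ n - 1) hD.1).mul
    (congrSq_qPoch_mul_qPoch_pow hQ.1 hQ.1 hu (s + e + 1) k).symm
  have h3 : qPoch (q ^ ((d : ℤ) + r)) (q ^ d) k ^ e * qPoch (q ^ (r : ℤ)) (q ^ d) k ^ s
      * qPoch (q ^ ((r : ℤ) - d)) (q ^ d) k * q ^ (d * k) ∈ cyclotomicLocal n :=
    Subring.mul_mem _ (Subring.mul_mem _ (Subring.mul_mem _ (Subring.pow_mem _ (mem _) _)
      (Subring.pow_mem _ (mem _) _)) (mem _)) (hq.pow _).1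
  have h4 := (h1.mul (CongrSq.refl h3)).div h2 (hD.mul (hD.pow _))
    (hD.mul ((isUnitIn_qPoch_shift_pow h _ hk).mul ((isUnitIn_qPoch_shift_inv h hk).pow _)))
  convert h4 using 1
  · congr 1 <;> ring
  · rfl

theorem q_zpow_add_add_add (a b c e : ℤ) :
    (q ^ (a + b + c + e) : RatFunc ℚ) = q ^ a * q ^ b * q ^ c * q ^ e := by
  have hq : q ≠ 0 := RatFunc.X_ne_zero
  rw [zpow_add₀ hq, zpow_add₀ hq, zpow_add₀ hq]

theorem sum_deformedTerm (hd : d = s + e + 3) (hr : r = s + 1) (hn : n + r = d * (p + 2))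
    (h : Nat.Coprime n d) (hN : p + 2 < n) :
    ∑ k ∈ Finset.range n, deformedTerm d r n s e k
      = (-1) ^ (n - 1 - (p + 2)) * q ^ (expA d n r - (r - d)) * qPoch (q ^ d) (q ^ d) (n - 1 - (p + 2))
        * ((1 - q ^ (r : ℤ)) ^ r * (1 - q ^ ((r : ℤ) - d)))
        / (qPoch (q ^ d * (q ^ n) ^ (s + e + 1)) (q ^ d) (p + 2)
          * qPoch (q ^ d * (q ^ n)⁻¹) (q ^ d) (p + 2) ^ (s + e + 1)) := by
  obtain ⟨N, hNe⟩ : ∃ N, N = n - 1 - (p + 2) := ⟨_, rfl⟩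
  rw [← hNe]
  have hq : q ≠ 0 := RatFunc.X_ne_zero
  have hQ : q ^ d ≠ 0 := pow_ne_zero _ hq
  have hnZ : (n : ℤ) + r = d * (p + 2) := by exact_mod_cast hn
  have hNZ : (N : ℤ) = n - 1 - (p + 2) := by omega
  have hdZ : (d : ℤ) = s + e + 3 := by exact_mod_cast hd
  have hrZ : (r : ℤ) = s + 1 := by exact_mod_cast hr
  -- the data of the summation formula
  set x : Fin 4 → RatFunc ℚ :=
    ![q ^ ((d : ℤ) + n * (d - 2)), q ^ ((d : ℤ) + n * (-1)), q ^ ((d : ℤ) + n * (-1)),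
      q ^ ((d : ℤ) + n * (-1))] with hx
  set m : Fin 4 → ℕ := ![p + 2, p + 2, p + 1, p] with hm
  set w : Fin 4 → ℕ := ![1, e, s, 1] with hw
  have hsum : N = ∑ i, w i * m i := by
    simp only [hm, hw, Fin.sum_univ_four, Matrix.cons_val]
    zify
    rw [hNZ]
    have : (n : ℤ) = (s + e + 3) * (p + 2) - (s + 1) := by
      rw [← hdZ, ← hrZ]; linear_combination hnZ
    rw [this]; ring
  have hunit : ∀ i, ∀ k < n, qPoch (x i) (q ^ d) k ≠ 0 := by
    intro i k hk
    fin_cases i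
    · exact (isUnitIn_qPoch_shift h _ hk).2.2
    · exact (isUnitIn_qPoch_shift h _ hk).2.2
    · exact (isUnitIn_qPoch_shift h _ hk).2.2
    · exact (isUnitIn_qPoch_shift h _ hk).2.2
  have key := sum_qPoch_karlsson_minton Finset.univ hQ x m w hsum
    (fun k h1 h2 => q_pow_ne_one h h1 (by omega))
    (fun i _ => hunit i _ (by fin_cases i <;> simp [hm] <;> omega))
    (fun i _ k hk => hunit i k (by omega))
  simp only [Fin.prod_univ_four, hx, hm, hw, Matrix.cons_val, q_zpow_mul_pow, neg_zpow_pow_mul,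
    pow_one] at key
  have ex1 : (d : ℤ) + n * (d - 2) + d * (p + 2 : ℕ) = d + r + n * (d - 1) := by
    push_cast; linear_combination -hnZ
  have ex2 : (d : ℤ) + n * (-1) + d * (p + 2 : ℕ) = d + r := by
    push_cast; linear_combination -hnZ
  have ex3 : (d : ℤ) + n * (-1) + d * (p + 1 : ℕ) = r := by
    push_cast; linear_combination -hnZ
  have ex4 : (d : ℤ) + n * (-1) + d * (p : ℕ) = r - d := by
    linear_combination -hnZ
  rw [ex1, ex2, ex3, ex4] at key
  have b1 : q ^ d * (q ^ n) ^ (s + e + 1) = q ^ ((d : ℤ) + n * (d - 2)) := by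
    rw [zpow_add₀ hq, zpow_mul, zpow_natCast, zpow_natCast,
      show (d : ℤ) - 2 = (s + e + 1 : ℕ) by push_cast; linarith, zpow_natCast]
  have b2 : q ^ d * (q ^ n)⁻¹ = q ^ ((d : ℤ) + n * (-1)) := by
    rw [zpow_add₀ hq, zpow_mul, zpow_natCast, zpow_natCast, zpow_neg_one]
  have b3 : q ^ ((d : ℤ) + r) * (q ^ n) ^ (d - 1) = q ^ ((d : ℤ) + r + n * (d - 1)) := by
    rw [zpow_add₀ hq (_ + _), zpow_mul, zpow_natCast _ n,
      show (d : ℤ) - 1 = (d - 1 : ℕ) by omega, zpow_natCast]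
  have b4 : q ^ ((d : ℤ) + r) * ((q ^ n) ^ (d - 1))⁻¹ = ((q ^ d) ^ N)⁻¹ := by
    rw [← pow_mul, ← pow_mul, ← zpow_natCast, ← zpow_natCast, ← zpow_neg, ← zpow_neg,
      ← zpow_add₀ hq]
    congr 1
    push_cast
    rw [hNZ, show ((d - 1 : ℕ) : ℤ) = d - 1 by omega]
    linear_combination hnZ
  have hterm : ∀ k ∈ Finset.range (N + 1), deformedTerm d r n s e k
      = qPoch ((q ^ d) ^ N)⁻¹ (q ^ d) k / qPoch (q ^ d) (q ^ d) k * (q ^ d) ^ k *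
        (qPoch (q ^ ((d : ℤ) + r + n * (d - 1))) (q ^ d) k /
            qPoch (q ^ ((d : ℤ) + n * (d - 2))) (q ^ d) k *
          (qPoch (q ^ ((d : ℤ) + r)) (q ^ d) k / qPoch (q ^ ((d : ℤ) + n * (-1))) (q ^ d) k) ^ e *
          (qPoch (q ^ (r : ℤ)) (q ^ d) k / qPoch (q ^ ((d : ℤ) + n * (-1))) (q ^ d) k) ^ s *
          (qPoch (q ^ ((r : ℤ) - d)) (q ^ d) k / qPoch (q ^ ((d : ℤ) + n * (-1))) (q ^ d) k)) := by
    intro k _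
    rw [deformedTerm, b4, b3, b2, b1]
    simp only [div_eq_mul_inv, mul_inv, pow_add, pow_one, pow_mul]
    ring
  have hrange : ∑ k ∈ Finset.range n, deformedTerm d r n s e k
      = ∑ k ∈ Finset.range (N + 1), deformedTerm d r n s e k := by
    refine (Finset.sum_subset (Finset.range_mono (by omega)) fun k _ hk => ?_).symm
    rw [Finset.mem_range, not_lt] at hk
    rw [deformedTerm, b4, qPoch_eq_zero (i := N) (by omega)
      (inv_mul_cancel₀ (pow_ne_zero _ hQ))]
    simp
  rw [hrange, Finset.sum_congr rfl hterm, key, b1, b2]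
  have c2 := qPoch_succ (q ^ ((d : ℤ) + n * (-1))) (q ^ d) (p + 1)
  have c1 := qPoch_succ (q ^ ((d : ℤ) + n * (-1))) (q ^ d) p
  rw [q_zpow_mul_pow, ex3] at c2
  rw [q_zpow_mul_pow, ex4] at c1
  have n0 := hunit 0 (p + 2) hN
  have n2 := hunit 1 (p + 2) hN
  have n1 := hunit 1 (p + 1) (by omega)
  have n3 := hunit 1 p (by omega)
  simp only [hx, Matrix.cons_val] at n0 n1 n2 n3
  have v1 : (1 - q ^ (r : ℤ) : RatFunc ℚ) ≠ 0 := fun h0 => n2 (by rw [c2, h0, mul_zero])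
  have v2 : (1 - q ^ ((r : ℤ) - d) : RatFunc ℚ) ≠ 0 := fun h0 => n1 (by rw [c1, h0, mul_zero])
  rw [div_pow, div_pow, neg_one_pow_mul_zpow_pow, neg_one_pow_mul_zpow_pow]
  have hE := exponent_eq hd hr hn
  have hz : (expA d n r - (r - d) : ℤ) = _ := (eq_sub_of_add_eq hE).symm
  have hsign : ((-1) ^ N : RatFunc ℚ)
      = (-1) ^ (p + 2) * (-1) ^ (e * (p + 2)) * (-1) ^ (s * (p + 1)) * (-1) ^ p := by
    rw [← pow_add, ← pow_add, ← pow_add, hsum]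
    congr 1
    simp only [hm, hw, Fin.sum_univ_four, Matrix.cons_val]
    ring
  rw [hz, hsign, mul_one, q_zpow_add_add_add]
  have d1 : qPoch (q ^ ((d : ℤ) + n * (-1))) (q ^ d) (p + 2) ^ (s + e + 1)
      = qPoch (q ^ ((d : ℤ) + n * (-1))) (q ^ d) (p + 2) ^ e
        * (qPoch (q ^ ((d : ℤ) + n * (-1))) (q ^ d) (p + 1) ^ s * (1 - q ^ (r : ℤ)) ^ s)
        * (qPoch (q ^ ((d : ℤ) + n * (-1))) (q ^ d) p * (1 - q ^ ((r : ℤ) - d))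
          * (1 - q ^ (r : ℤ))) := by
    rw [← mul_pow, ← c2, ← c1, ← c2, show p + 1 + 1 = p + 2 from rfl]; ring
  rw [d1, hr, pow_succ (1 - _) s]
  rw [hr] at v1 v2
  field_simp

theorem congrSq_of_two_le (hd : d = s + e + 3) (hr : r = s + 1) (hn : n + r = d * (p + 2))
    (h : Nat.Coprime n d) (hN : p + 2 < n) :
    CongrSq (cyclotomicLocal n) (q ^ n - 1)
      (∑ k ∈ Finset.range n, qPoch (q ^ ((d : ℤ) + r)) (q ^ d) k ^ (e + 2)
        * qPoch (q ^ (r : ℤ)) (q ^ d) k ^ s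
        * qPoch (q ^ ((r : ℤ) - d)) (q ^ d) k * q ^ (d * k) / qPoch (q ^ d) (q ^ d) k ^ (s + e + 3))
      ((-1) ^ (n - 1 - (p + 2)) * q ^ (expA d n r - (r - d))
        * qPoch (q ^ d) (q ^ d) (n - 1 - (p + 2))
        * ((1 - q ^ (r : ℤ)) ^ r * (1 - q ^ ((r : ℤ) - d)))
        / qPoch (q ^ d) (q ^ d) (p + 2) ^ (s + e + 2)) := by
  have h1 := CongrSq.sum fun k hk =>
    congrSq_deformedTerm (r := r) (e := e) (s := s) h (Finset.mem_range.1 hk)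
  rw [sum_deformedTerm hd hr hn h hN] at h1
  refine h1.trans ?_
  have hq := isUnitIn_q (n := n) (by omega)
  have hQ := hq.pow d
  have one_sub (a : ℤ) : 1 - q ^ a ∈ cyclotomicLocal n :=
    Subring.sub_mem _ (Subring.one_mem _) (hq.zpow a).1
  refine (CongrSq.refl ?_).div (congrSq_qPoch_mul_qPoch_pow hQ.1 hQ.1 (hq.pow n) (s + e + 1) _)
    ((isUnitIn_qPoch_shift_pow h _ hN).mul ((isUnitIn_qPoch_shift_inv h hN).pow _))
    ((isUnitIn_qPoch_self h hN).pow _)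
  exact Subring.mul_mem _ (Subring.mul_mem _ (Subring.mul_mem _ (IsUnitIn.one.neg.pow _).1
    (hq.zpow _).1) (qPoch_mem hQ.1 hQ.1 _))
    (Subring.mul_mem _ (Subring.pow_mem _ (one_sub _) _) (one_sub _))

theorem sum_qPoch_inv_pow_mul_qPoch_pow {K : Type*} [Field K] {b : K} (hb : b ≠ 0) {N n : ℕ}
    (hN : N < n) (h : ∀ k, 1 ≤ k → k ≤ N → b ^ k ≠ 1) :
    ∑ k ∈ Finset.range n, qPoch ((b ^ N)⁻¹) b k * qPoch (b * b ^ N) b k * b ^ k / qPoch b b k ^ 2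
      = (-b) ^ N * b ^ N.choose 2 := by
  have hu : ∀ k ≤ N, qPoch b b k ≠ 0 := fun k hk => qPoch_ne_zero fun i hi => by
    rw [← pow_succ']
    exact sub_ne_zero.2 (h (i + 1) (by omega) (by omega)).symm
  have key := sum_qPoch_karlsson_minton {()} hb (fun _ => b) (fun _ => N) (fun _ => 1) (N := N)
    (by simp) h (fun _ _ => hu N le_rfl) (fun _ _ => hu)
  simp only [Finset.prod_singleton, pow_one] at key
  rw [mul_div_cancel₀ _ (hu N le_rfl)] at key
  rw [← key]
  refine (Finset.sum_subset (Finset.range_mono (by omega)) fun k _ hk => ?_).symm.trans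
    (Finset.sum_congr rfl fun k _ => ?_)
  · rw [Finset.mem_range, not_lt] at hk
    rw [qPoch_eq_zero (i := N) (by omega) (inv_mul_cancel₀ (pow_ne_zero _ hb))]
    simp
  · simp only [div_eq_mul_inv, sq, mul_inv]
    ring

theorem isAffineSq_qPoch_mul_qPoch {K : Type*} [Field K] {O : Subring K} {b c c' u : K}
    (hb : b ∈ O) (hc : c ∈ O) (hc' : c' ∈ O) (hu : IsUnitIn O u) (k : ℕ) :
    IsAffineSq O (u - 1) (qPoch (c' * u⁻¹) b k * qPoch (c * u) b k) (qPoch c' b k * qPoch c b k)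
      (qPoch (c' * u) b k * qPoch (c * u⁻¹) b k) := by
  have ht := O.sub_mem hu.1 O.one_mem
  refine (IsAffineSq.prod ht fun i _ => ?_).mul (IsAffineSq.prod ht fun i _ => ?_)
  · rw [mul_right_comm c' u⁻¹, mul_right_comm c' u]
    exact isAffineSq_one_sub_mul_inv (O.mul_mem hc' (O.pow_mem hb i)) hu
  · rw [mul_right_comm c u, mul_right_comm c u⁻¹]
    exact isAffineSq_one_sub_mul (O.mul_mem hc (O.pow_mem hb i)) hu

theorem isUnitIn_natCast_cyclotomicLocal {n k : ℕ} (hk : k ≠ 0) :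
    IsUnitIn (cyclotomicLocal n) (k : RatFunc ℚ) := by
  have h0 : (k : ℚ) ≠ 0 := by exact_mod_cast hk
  have := isUnitIn_algebraMap (n := n) (A := Polynomial.C (k : ℚ)) (Polynomial.C_ne_zero.2 h0)
    ((isCoprime_one_left).of_isCoprime_of_dvd_left
      (isUnit_iff_dvd_one.1 (Polynomial.isUnit_C.2 h0.isUnit)))
  simpa using this

theorem congrSq_two_one {n p : ℕ} (hn : n = 2 * p + 3) :
    CongrSq (cyclotomicLocal n) (q ^ n - 1)
      (∑ k ∈ Finset.range n,
        qPoch (q ^ 3) (q ^ 2) k * qPoch q⁻¹ (q ^ 2) k * q ^ (2 * k) / qPoch (q ^ 2) (q ^ 2) k ^ 2)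
      ((1 - q) * (1 - q) * qPoch (q ^ 2) (q ^ 2) p
        / (-(-1) ^ p * qPoch (q ^ 2) (q ^ 2) (p + 2)) * q ^ (p ^ 2 + 5 * p + 5)) := by
  have hq0 : q ≠ 0 := RatFunc.X_ne_zero
  have hn0 : 0 < n := by omega
  have hcop : Nat.Coprime n 2 := by
    rw [hn, Nat.coprime_two_right]; exact ⟨p + 1, by ring⟩
  have hq := isUnitIn_q hn0
  have hQ := hq.pow 2
  have hu := hq.pow n
  have hQ0 := hQ.2.2
  have ho : ∀ k, 1 ≤ k → k < n → ((q ^ 2) ^ k : RatFunc ℚ) ≠ 1 := fun k h1 h2 =>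
    q_pow_ne_one hcop h1 h2
  have h1 : CongrSq (cyclotomicLocal n) (q ^ n - 1)
      (2 * ∑ k ∈ Finset.range n,
        qPoch (q ^ 3) (q ^ 2) k * qPoch q⁻¹ (q ^ 2) k * q ^ (2 * k) / qPoch (q ^ 2) (q ^ 2) k ^ 2)
      ((-q ^ 2) ^ (p + 2) * (q ^ 2) ^ (p + 2).choose 2 + (-q ^ 2) ^ p * (q ^ 2) ^ p.choose 2) := by
    rw [← sum_qPoch_inv_pow_mul_qPoch_pow hQ0 (by omega : p + 2 < n)
      fun k h1 h2 => ho k h1 (by omega), ← sum_qPoch_inv_pow_mul_qPoch_pow hQ0 (by omega : p < n)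
      fun k h1 h2 => ho k h1 (by omega), ← Finset.sum_add_distrib, Finset.mul_sum]
    refine CongrSq.sum fun k hk => ?_
    have h2 := (isAffineSq_qPoch_mul_qPoch hQ.1 (hq.pow 3).1 hq.2.1 hu k).add_congrSq
    have hD := (isUnitIn_qPoch_self hcop (Finset.mem_range.1 hk)).pow 2
    have h3 := (h2.mul (CongrSq.refl (hq.pow (2 * k)).1)).div (CongrSq.refl hD.1) hD hD
    convert h3 using 1
    · ring
    · rw [show q⁻¹ * (q ^ n)⁻¹ = ((q ^ 2) ^ (p + 2))⁻¹ by
          rw [hn, ← mul_inv, ← pow_mul, ← pow_succ']; congr 2,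
        show q ^ 3 * q ^ n = q ^ 2 * (q ^ 2) ^ (p + 2) by rw [hn]; ring,
        show q⁻¹ * q ^ n = q ^ 2 * (q ^ 2) ^ p by rw [hn]; field_simp; ring,
        show q ^ 3 * (q ^ n)⁻¹ = ((q ^ 2) ^ p)⁻¹ by rw [hn]; field_simp; ring]
      ring
  have hs := (IsUnitIn.one (O := cyclotomicLocal n)).neg.pow p
  have hE := hs.mul (hq.pow (p ^ 2 + 3 * p + 3))
  -- both sides are congruent to `(-1) ^ p * q ^ (p ^ 2 + 3 * p + 3)`
  have h2 : CongrSq (cyclotomicLocal n) (q ^ n - 1) (q ^ n + (q ^ n)⁻¹) 2 := by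
    refine ⟨Subring.add_mem _ hu.1 hu.2.1, (isUnitIn_natCast_cyclotomicLocal two_ne_zero).1,
      (q ^ n)⁻¹, hu.2.1, ?_⟩
    have := hu.2.2
    field_simp
    ring
  have htwo : IsUnitIn (cyclotomicLocal n) (2 : RatFunc ℚ) :=
    isUnitIn_natCast_cyclotomicLocal two_ne_zero
  have h3 : CongrSq (cyclotomicLocal n) (q ^ n - 1) (∑ k ∈ Finset.range n,
        qPoch (q ^ 3) (q ^ 2) k * qPoch q⁻¹ (q ^ 2) k * q ^ (2 * k) / qPoch (q ^ 2) (q ^ 2) k ^ 2)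
      ((-1) ^ p * q ^ (p ^ 2 + 3 * p + 3)) := by
    have hc : p.choose 2 * 2 = p * (p - 1) := Nat.choose_two_right p ▸
      Nat.div_mul_cancel (Nat.even_mul_pred_self p).two_dvd
    have hc2 : (p + 2).choose 2 = p.choose 2 + 2 * p + 1 := by
      simp [Nat.choose_succ_succ' _ 1]; ring
    have e2 : 2 * p + 2 * p.choose 2 = p ^ 2 + p := by
      rcases p with _ | p
      · simp
      · simp only [Nat.add_sub_cancel] at hc; linarith
    have h4 : (-q ^ 2) ^ (p + 2) * (q ^ 2) ^ (p + 2).choose 2 + (-q ^ 2) ^ p * (q ^ 2) ^ p.choose 2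
        = (-1) ^ p * q ^ (p ^ 2 + 3 * p + 3) * (q ^ n + (q ^ n)⁻¹) := by
      have hs2 : ((-1 : RatFunc ℚ)) ^ (p + 2) = (-1) ^ p := by rw [pow_add, neg_one_sq, mul_one]
      rw [neg_pow (q ^ 2) (p + 2), neg_pow (q ^ 2) p, hs2, hc2, mul_assoc ((-1) ^ p) ((q ^ 2) ^ _),
        mul_assoc ((-1) ^ p) ((q ^ 2) ^ _),
        ← pow_mul, ← pow_mul, ← pow_mul, ← pow_mul, ← pow_add, ← pow_add, e2,
        show 2 * (p + 2) + 2 * (p.choose 2 + 2 * p + 1) = p ^ 2 + p + (4 * p + 6) by omega, hn]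
      field_simp
      ring
    have h5 := ((h4 ▸ h1).trans ((CongrSq.refl hE.1).mul h2)).div (CongrSq.refl htwo.1) htwo htwo
    rwa [mul_div_cancel_left₀ _ htwo.2.2, mul_div_cancel_right₀ _ htwo.2.2] at h5
  refine h3.trans (CongrSq.symm ?_)
  have v0 : IsUnitIn (cyclotomicLocal n) (1 - q) := by
    simpa using isUnitIn_one_sub_q_zpow hn0 (e := 1) (by
      intro h; have := Int.le_of_dvd one_pos h; omega)
  have hP := isUnitIn_qPoch_self hcop (by omega : p + 2 < n)
  have e1 : qPoch (q ^ 2) (q ^ 2) (p + 2)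
      = qPoch (q ^ 2) (q ^ 2) p * ((1 - q⁻¹ * q ^ n) * (1 - q * q ^ n)) := by
    rw [qPoch_succ, qPoch_succ, mul_assoc,
      show q ^ 2 * (q ^ 2) ^ p = q⁻¹ * q ^ n by rw [hn]; field_simp; ring,
      show q ^ 2 * (q ^ 2) ^ (p + 1) = q * q ^ n by rw [hn]; ring]
  have hP' := isUnitIn_qPoch_self hcop (by omega : p < n)
  have v1 : IsUnitIn (cyclotomicLocal n) ((1 - q⁻¹ * q ^ n) * (1 - q * q ^ n)) := by
    have := hP'.inv.mul hP
    rwa [e1, inv_mul_cancel_left₀ hP'.2.2] at this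
  have v2 : IsUnitIn (cyclotomicLocal n) (-(q ^ n * q⁻¹ * ((1 - q) * (1 - q)))) :=
    ((hu.mul hq.inv).mul (v0.mul v0)).neg
  have h6 : CongrSq (cyclotomicLocal n) (q ^ n - 1) ((1 - q⁻¹ * q ^ n) * (1 - q * q ^ n))
      (-(q ^ n * q⁻¹ * ((1 - q) * (1 - q)))) := by
    refine ⟨v1.1, v2.1, 1, Subring.one_mem _, ?_⟩
    field_simp
    ring
  have hnum := (v0.mul v0).mul (hs.mul (hq.pow (p ^ 2 + 5 * p + 5))).neg
  have h7 := (CongrSq.refl (t := q ^ n - 1) hnum.1).div h6 v1 v2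
  have hsq : ((-1 : RatFunc ℚ) ^ p) * (-1) ^ p = 1 := by
    rw [← mul_pow]; simp
  have hv0 := v0.2.2
  have hsinv : ((-1 : RatFunc ℚ) ^ p)⁻¹ = (-1) ^ p := inv_eq_of_mul_eq_one_left hsq
  convert h7 using 1
  · rw [e1, div_eq_mul_inv, mul_inv, mul_inv, inv_neg, hsinv]
    linear_combination (-(1 - q) * (1 - q) * (-1) ^ p * q ^ (p ^ 2 + 5 * p + 5) *
      ((1 - q⁻¹ * q ^ n) * (1 - q * q ^ n))⁻¹) * mul_inv_cancel₀ hP'.2.2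
  · rw [hn]
    field_simp
    ring

end QSuper

end

open QSuper in
theorem theorem4p1 (d r n : ℕ) (hr : 1 ≤ r)
    (hd : r + 3 ≤ d ∨ (r = 1 ∧ (d = 2 ∨ d = 3)))
    (hdr : Nat.gcd d r = 1)
    (hn : (n : ℤ) ≡ -(r : ℤ) [ZMOD (d : ℤ)])
    (hn' : 2 * (d : ℤ) - (r : ℤ) ≤ (n : ℤ)) :
    CongrMod (Polynomial.cyclotomic n ℚ ^ 2)
      (∑ k ∈ Finset.range n,
        qPoch (q ^ (d + r)) (q ^ d) k ^ (d - r) * qPoch (q ^ r) (q ^ d) k ^ (r - 1)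
          * qPoch (q ^ ((r : ℤ) - (d : ℤ))) (q ^ d) k * q ^ (d * k)
          / qPoch (q ^ d) (q ^ d) k ^ d)
      ((1 - q ^ r) ^ r * (1 - q ^ (d - r)) * qPoch (q ^ d) (q ^ d) (n - 1 - (n + r) / d)
        / (-(-1) ^ (n - 1 - (n + r) / d) * qPoch (q ^ d) (q ^ d) ((n + r) / d) ^ (d - 1))
        * q ^ expA d n r) := by
  have hq0 : q ≠ 0 := RatFunc.X_ne_zero
  obtain ⟨m, hm⟩ : d ∣ n + r := by
    have h1 := (Int.modEq_iff_dvd.1 hn.symm)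
    rw [sub_neg_eq_add] at h1
    exact_mod_cast h1
  have hd0 : 0 < d := by omega
  have hm2 : 2 ≤ m := by
    have h1 : 2 * d ≤ n + r := by omega
    rw [hm, mul_comm] at h1
    exact Nat.le_of_mul_le_mul_left h1 hd0
  obtain ⟨p, rfl⟩ := Nat.exists_eq_add_of_le' hm2
  rw [hm, Nat.mul_div_cancel_left _ hd0]
  refine congrMod_of_congrSq ?_
  by_cases h2 : d = 2
  · obtain rfl : r = 1 := by omega
    subst h2
    have hnp : n = 2 * p + 3 := by omega
    have hA : expA (2 : ℕ) n (1 : ℕ) = (p ^ 2 + 5 * p + 5 : ℕ) := by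
      rw [← Int.cast_inj (α := ℚ), expA_cast (by norm_num) (by exact_mod_cast Dvd.intro _ hm.symm),
        hnp]
      push_cast
      ring
    convert congrSq_two_one hnp using 1
    · refine Finset.sum_congr rfl fun k _ => ?_
      norm_num
    · rw [hA, zpow_natCast, show n - 1 - (p + 2) = p by omega]
      norm_num
  · obtain ⟨s, rfl⟩ := Nat.exists_eq_add_of_le' hr
    obtain ⟨e, he⟩ : ∃ e, d = s + e + 3 := ⟨d - s - 3, by omega⟩
    have hN : p + 2 < n := by
      have h1 : n + (s + 1) = (s + e + 3) * (p + 2) := by rw [← he, hm]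
      nlinarith
    have hcop : Nat.Coprime n d := by
      have h1 : Nat.gcd n d ∣ s + 1 := (Nat.dvd_add_right (Nat.gcd_dvd_left n d)).1
        (hm ▸ Dvd.dvd.mul_right (Nat.gcd_dvd_right n d) _)
      exact Nat.dvd_one.1 (hdr ▸ Nat.dvd_gcd (Nat.gcd_dvd_right n d) h1)
    have key := congrSq_of_two_le he rfl hm hcop hN
    have hu : IsUnitIn (cyclotomicLocal n) (qPoch (q ^ d) (q ^ d) (p + 2)) :=
      isUnitIn_qPoch_self hcop hN
    convert key using 1
    · refine Finset.sum_congr rfl fun k _ => ?_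
      rw [show d - (s + 1) = e + 2 by omega, Nat.add_sub_cancel, ← he, ← zpow_natCast q (d + (s + 1)),
        ← zpow_natCast q (s + 1)]
      push_cast
      rfl
    · have hs : ((-1 : RatFunc ℚ) ^ (n - 1 - (p + 2)))⁻¹ = (-1) ^ (n - 1 - (p + 2)) :=
        inv_eq_of_mul_eq_one_left (by rw [← mul_pow]; simp)
      have h3 : (1 - q ^ (((s + 1 : ℕ) : ℤ) - d) : RatFunc ℚ)
          = -(q ^ (((s + 1 : ℕ) : ℤ) - d) * (1 - q ^ (d - (s + 1)))) := by
        rw [← zpow_natCast q (d - (s + 1)), Nat.cast_sub (by omega), mul_sub, ← zpow_add₀ hq0]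
        simp
      rw [h3, zpow_sub₀ hq0 (expA _ _ _), zpow_natCast, show s + e + 2 = d - 1 by omega,
        div_eq_mul_inv, mul_inv, inv_neg, hs]
      have := zpow_ne_zero (((s + 1 : ℕ) : ℤ) - d) hq0
      have := hu.2.2
      field_simp
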